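/- **Theorem.** For graphs $G_A=([n],E_A)$ (held by Alice) and $G_B=([n],E_B)$ (held by Bob), where $E_A$ and $E_B$ may overlap, let $\textsc{Bipartite}_n(G_A,G_B)=1$ if the graph $([n],E_A\cup E_B)$ is bipartite and $0$ otherwise. Let $D(f)$ be the deterministic two-party communication complexity of $f$ (the minimal depth of a protocol tree computing $f$), let $Q_2(f)$ be its quantum communication complexity with error probability at most $1/3$ on every input and without prior entanglement, and let $Q_2^*(f)$ be the same with unlimited prior entanglement, i.e. the players may start with any shared finite-dimensional pure state that does not depend on the inputs. In a quantum protocol the players have private quantum registers of any finite dimension and in each step one of them sends a qubit, or a classical bit obtained by a measurement on which the rest of the protocol, including who speaks next, may depend; the cost is the worst-case total number of qubits and bits sent, and at the end one of the players measures to obtain the output. Then $$\Omega(n)\;\le\; Q_2^*(\textsc{Bipartite}_n)\;\le\; Q_2(\textsc{Bipartite}_n)\;\le\; D(\textsc{Bipartite}_n)\;\le\; O(n\log n).$$ That is, there are constants $c,C>0$ such that $c\,n\le Q_2^*(\textsc{Bipartite}_n)$ and $D(\textsc{Bipartite}_n)\le C\,n\log n$ for all sufficiently large $n$, and the two middle inequalities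 hold for every $n$. -/

import Mathlib

open scoped ENNReal Matrix

namespace CommComplexity

/-- Deterministic two-party protocol tree. At an inner node one player announces a bit that depends
on that player's input; the rest of the protocol (in particular who speaks next) depends on the bits
announced so far. Leaves carry the output. -/
inductive DetProtocol (X Y : Type) : Type
  | output (v : Bool) : DetProtocol X Y
  | aliceBit (g : X → Bool) (next : Bool → DetProtocol X Y) : DetProtocol X Y
  | bobBit (g : Y → Bool) (next : Bool → DetProtocol X Y) : DetProtocol X Y

namespace DetProtocol

variable {X Y : Type}

/-- The output of the protocol on the input pair `(x, y)`. -/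
def eval (x : X) (y : Y) : DetProtocol X Y → Bool
  | output v => v
  | aliceBit g next => eval x y (next (g x))
  | bobBit g next => eval x y (next (g y))

/-- The worst-case number of bits communicated, i.e. the depth of the tree. -/
def cost : DetProtocol X Y → ℕ
  | output _ => 0
  | aliceBit _ next => 1 + max (cost (next false)) (cost (next true))
  | bobBit _ next => 1 + max (cost (next false)) (cost (next true))

end DetProtocol

/-- The deterministic communication complexity `D(f)`: the least cost of a deterministic protocol
that outputs `f x y` on all inputs. -/
noncomputable def detComplexity {X Y : Type} (f : X → Y → Bool) : ℕ∞ :=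
  ⨅ (P : DetProtocol X Y) (_ : ∀ x y, P.eval x y = f x y), (P.cost : ℕ∞)

/-- A two-outcome quantum measurement from a register of dimension `a` to one of dimension `a'`,
given by its measurement operators. -/
def Measurement (a a' : ℕ) : Type :=
  {K : Bool → Matrix (Fin a') (Fin a) ℂ // ∑ s, (K s)ᴴ * K s = 1}

/-- An isometry from a register of dimension `a` to a register of dimension `a'` together with one
message qubit (a unitary that may use ancillas in a fixed state). -/
def QubitIsometry (a a' : ℕ) : Type :=
  {V : Matrix (Fin a' × Fin 2) (Fin a) ℂ // Vᴴ * V = 1}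

/-- Two-party quantum protocol that starts with an Alice register of dimension `a` and a Bob
register of dimension `b`. In a step one player
* sends a qubit: an isometry depending on the input splits the register into a new private register
  and one qubit, which joins the other player's register; or
* sends a classical bit: a measurement depending on the input is made on the register, and the
  outcome is told to the other player; the rest of the protocol (in particular who speaks next) may
  depend on it, as in a deterministic protocol tree.
At the end one player measures to determine the output. -/
inductive QProtocol (X Y : Type) : ℕ → ℕ → Type
  | aliceOutput {a b a' : ℕ} (M : X → Measurement a a') : QProtocol X Y a b
  | bobOutput {a b b' : ℕ} (M : Y → Measurement b b') : QProtocol X Y a b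
  | aliceBit {a b a' : ℕ} (M : X → Measurement a a') (next : Bool → QProtocol X Y a' b) :
      QProtocol X Y a b
  | bobBit {a b b' : ℕ} (M : Y → Measurement b b') (next : Bool → QProtocol X Y a b') :
      QProtocol X Y a b
  | aliceQubit {a b a' : ℕ} (V : X → QubitIsometry a a') (next : QProtocol X Y a' (b * 2)) :
      QProtocol X Y a b
  | bobQubit {a b b' : ℕ} (V : Y → QubitIsometry b b') (next : QProtocol X Y (a * 2) b') :
      QProtocol X Y a b

/-- A pure, not necessarily normalized, state of an Alice register of dimension `a` and a Bob
register of dimension `b`, that is an element of `ℂ^a ⊗ ℂ^b`, as its matrix of amplitudes.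
An operator `K` of Alice maps `ψ` to `K * ψ`, an operator `L` of Bob maps it to `ψ * Lᵀ`. -/
abbrev State (a b : ℕ) : Type := Matrix (Fin a) (Fin b) ℂ

/-- The squared Hilbert space norm of a state. -/
noncomputable def State.normSq {a b : ℕ} (ψ : State a b) : ℝ := ∑ i, ∑ j, ‖ψ i j‖ ^ 2

/-- Move a qubit from Alice's side to Bob's register. -/
def qubitToBob {a b : ℕ} (φ : Matrix (Fin a × Fin 2) (Fin b) ℂ) : State a (b * 2) :=
  fun i k => φ (i, (finProdFinEquiv.symm k).2) (finProdFinEquiv.symm k).1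

/-- Move a qubit from Bob's side to Alice's register. -/
def qubitToAlice {a b : ℕ} (φ : Matrix (Fin a) (Fin b × Fin 2) ℂ) : State (a * 2) b :=
  fun k j => φ (finProdFinEquiv.symm k).1 (j, (finProdFinEquiv.symm k).2)

namespace QProtocol

variable {X Y : Type}

/-- The probability that the protocol, on inputs `x`, `y` and initial state `ψ`, outputs `v`.
States after a measurement are left unnormalized, so that the squared norm of the state reached at
the end of a branch is the probability of that branch. -/
noncomputable def prob (x : X) (y : Y) (v : Bool) :
    {a b : ℕ} → QProtocol X Y a b → State a b → ℝ
  | _, _, aliceOutput M, ψ => State.normSq ((M x).1 v * ψ)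
  | _, _, bobOutput M, ψ => State.normSq (ψ * ((M y).1 v)ᵀ)
  | _, _, aliceBit M next, ψ => ∑ s, prob x y v (next s) ((M x).1 s * ψ)
  | _, _, bobBit M next, ψ => ∑ s, prob x y v (next s) (ψ * ((M y).1 s)ᵀ)
  | _, _, aliceQubit V next, ψ => prob x y v next (qubitToBob ((V x).1 * ψ))
  | _, _, bobQubit V next, ψ => prob x y v next (qubitToAlice (ψ * ((V y).1)ᵀ))

/-- The worst-case number of qubits and bits communicated. -/
def cost : {a b : ℕ} → QProtocol X Y a b → ℕ
  | _, _, aliceOutput _ => 0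
  | _, _, bobOutput _ => 0
  | _, _, aliceBit _ next => 1 + max (cost (next false)) (cost (next true))
  | _, _, bobBit _ next => 1 + max (cost (next false)) (cost (next true))
  | _, _, aliceQubit _ next => 1 + cost next
  | _, _, bobQubit _ next => 1 + cost next

/-- Started in the state `ψ`, the protocol outputs `f x y` with probability at least `2/3`, for all
inputs. -/
def Computes {a b : ℕ} (P : QProtocol X Y a b) (ψ : State a b) (f : X → Y → Bool) : Prop :=
  ∀ x y, 2 / 3 ≤ P.prob x y (f x y) ψ

end QProtocol

/-- The quantum communication complexity `Q₂(f)` with error at most `1/3` and without prior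
entanglement: both registers are initially trivial (one-dimensional); ancillas and private coins
are created locally by the isometries and measurements. -/
noncomputable def quantumComplexity {X Y : Type} (f : X → Y → Bool) : ℕ∞ :=
  ⨅ (P : QProtocol X Y 1 1) (_ : P.Computes 1 f), (P.cost : ℕ∞)

/-- The quantum communication complexity with error at most `1/3` and with unlimited prior
entanglement: the players start with an arbitrary shared finite-dimensional state (independent of
their inputs). -/
noncomputable def entangledComplexity {X Y : Type} (f : X → Y → Bool) : ℕ∞ :=
  ⨅ (a : ℕ) (b : ℕ) (ψ : State a b) (_ : ψ.normSq = 1) (P : QProtocol X Y a b)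
    (_ : P.Computes ψ f), (P.cost : ℕ∞)

open Classical in
/-- The problem `Bipartite_n`: Alice and Bob hold the graphs `([n], E_A)` and `([n], E_B)`, whose
edge sets may overlap, and have to decide whether `([n], E_A ∪ E_B)` is bipartite. -/
noncomputable def bipartite (n : ℕ) (G H : SimpleGraph (Fin n)) : Bool :=
  decide (G ⊔ H).IsBipartite

end CommComplexity

namespace CommComplexity

/-! ### Two-colourings -/

/-! The union of two graphs is bipartite iff they share a proper two-colouring, so everything about
Alice's graph that matters is its set of proper two-colourings.

Upper bound: that set is described by a representative of each vertex's class and a relative colour,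
or by the information that it is empty (`decode_coloringCode`). There are `(2n)^n + 1` such
descriptions, so Alice sends hers in `O(n log n)` bits and Bob answers. The middle inequalities hold
because a deterministic protocol is a quantum one on trivial registers, and the trivial state is an
admissible shared state.

Lower bound: inner product modulo two on about `n / 4` bits embeds into bipartiteness. A cycle
passes through gadgets so that the parity of its length is the inner product
(`exists_coloring_iff_innerProductSign`). For the hardness of inner product, pull the final
measurement back through the protocol: an output probability is a sum of at most `4 ^ cost` terms
`tr(ψᴴ A(x) ψ C(y))` with contractions `A`, `C` (`QProtocol.exists_local_terms`). Each term is an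
inner product of a vector depending on `x` with one depending on `y`, both in the unit ball,
whatever the dimension of the entanglement. By `norm_sum_mul_inner_sq_le` its correlation with the
`2^m × 2^m` sign matrix is at most `2^(3m/2)`, whereas a correct protocol needs correlation of order
`2^(2m)`. Hence `4 ^ cost` is at least of order `2^(m/2)`. -/

/-- The proper two-colourings of a graph. -/
def properTwoColorings {V : Type} (G : SimpleGraph V) : Set (V → Bool) :=
  {χ | ∀ u v, G.Adj u v → χ u ≠ χ v}

theorem isBipartite_iff_nonempty {V : Type} (G : SimpleGraph V) :
    G.IsBipartite ↔ (properTwoColorings G).Nonempty := by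
  constructor
  · rintro ⟨C⟩
    exact ⟨fun v => finTwoEquiv (C v), fun u v h => finTwoEquiv.injective.ne (C.valid h)⟩
  · rintro ⟨χ, hχ⟩
    exact ⟨SimpleGraph.Coloring.mk (fun v => finTwoEquiv.symm (χ v))
      fun {u v} h => finTwoEquiv.symm.injective.ne (hχ u v h)⟩

theorem properTwoColorings_sup {V : Type} (G H : SimpleGraph V) :
    properTwoColorings (G ⊔ H) = properTwoColorings G ∩ properTwoColorings H := by
  ext χ
  simp only [properTwoColorings, SimpleGraph.sup_adj, Set.mem_ofPred_eq, Set.mem_inter_iff]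
  exact ⟨fun h => ⟨fun u v e => h u v (Or.inl e), fun u v e => h u v (Or.inr e)⟩,
    fun h u v e => e.elim (h.1 u v) (h.2 u v)⟩

/-- Vertices outside the range of `f` are isolated and can take any colour. This lets the gadget
graph be padded to exactly `n` vertices. -/
theorem properTwoColorings_map_inter_nonempty {V W : Type} (f : V ↪ W) (G H : SimpleGraph V) :
    (properTwoColorings (G.map f) ∩ properTwoColorings (H.map f)).Nonempty ↔
      (properTwoColorings G ∩ properTwoColorings H).Nonempty := by
  constructor
  · rintro ⟨χ, hG, hH⟩
    exact ⟨χ ∘ f, fun u v h => hG _ _ (SimpleGraph.map_adj_apply.2 h),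
      fun u v h => hH _ _ (SimpleGraph.map_adj_apply.2 h)⟩
  · rintro ⟨χ, hG, hH⟩
    have extend : ∀ K : SimpleGraph V, χ ∈ properTwoColorings K →
        Function.extend f χ (fun _ => false) ∈ properTwoColorings (K.map f) := by
      intro K hK u v h
      obtain ⟨u', v', h', rfl, rfl⟩ := (SimpleGraph.map_adj f K u v).1 h
      rw [f.injective.extend_apply, f.injective.extend_apply]
      exact hK _ _ h'
    exact ⟨_, extend G hG, extend H hH⟩

theorem bipartite_eq_true_iff {n : ℕ} (G H : SimpleGraph (Fin n)) :
    bipartite n G H = true ↔ (properTwoColorings G ∩ properTwoColorings H).Nonempty := by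
  rw [← properTwoColorings_sup, ← isBipartite_iff_nonempty]
  classical exact decide_eq_true_iff

/-! ### The deterministic upper bound -/

/-- Two vertices are linked if in all proper two-colourings they have the same colour, or in all of
them different colours. -/
def linkedSetoid {V : Type} (G : SimpleGraph V) : Setoid V where
  r i j := ∃ b, ∀ χ ∈ properTwoColorings G, χ i = xor (χ j) b
  iseqv :=
    { refl := fun i => ⟨false, by simp⟩
      symm := by
        rintro i j ⟨b, h⟩
        exact ⟨b, fun χ hχ => by rw [h χ hχ]; simp⟩
      trans := by
        rintro i j k ⟨b, h⟩ ⟨c, h'⟩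
        exact ⟨xor c b, fun χ hχ => by rw [h χ hχ, h' χ hχ, Bool.xor_assoc]⟩ }

/-- The chosen representative of the vertices linked to `i`. -/
noncomputable def linkedRep {V : Type} (G : SimpleGraph V) (i : V) : V :=
  (Quotient.mk (linkedSetoid G) i).out

open Classical in
/-- For a bipartite graph, the representative of each vertex and the colour relative to it. -/
noncomputable def coloringCode {V : Type} (G : SimpleGraph V) : Option (V → V × Bool) :=
  if h : (properTwoColorings G).Nonempty then
    some fun i => (linkedRep G i, xor (h.choose i) (h.choose (linkedRep G i)))
  else none

/-- The colourings described by a code. -/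
def decodeColorings {V : Type} : Option (V → V × Bool) → Set (V → Bool)
  | none => ∅
  | some c => {χ | ∀ i, χ i = xor (χ (c i).1) (c i).2}

/-- The colour relative to the representative is the same in all proper colourings, so one chosen
colouring reveals it. Conversely, adjacent vertices are linked, hence share a representative, and
their recorded offsets differ because the chosen colouring separates them. -/
theorem decode_coloringCode {V : Type} (G : SimpleGraph V) :
    decodeColorings (coloringCode G) = properTwoColorings G := by
  by_cases h : (properTwoColorings G).Nonempty
  · have key : ∀ i, ∀ χ ∈ properTwoColorings G,
        χ i = xor (χ (linkedRep G i)) (xor (h.choose i) (h.choose (linkedRep G i))) := by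
      intro i χ hχ
      obtain ⟨b, hb⟩ : (linkedSetoid G).r (linkedRep G i) i := Quotient.mk_out i
      rw [hb χ hχ, hb _ h.choose_spec]
      cases χ i <;> cases h.choose i <;> simp
    rw [coloringCode, dif_pos h]
    ext χ
    refine ⟨fun hχ u v huv => ?_, fun hχ i => key i χ hχ⟩
    have huv' : linkedRep G u = linkedRep G v := by
      refine congrArg Quotient.out (Quotient.sound ⟨true, fun χ hχ => ?_⟩)
      have := hχ u v huv
      revert this
      cases χ u <;> cases χ v <;> simp
    have hu := hχ u
    have hv := hχ v
    have h0 := h.choose_spec u v huv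
    simp only [huv'] at hu
    simp only at hv
    rw [hu, hv]
    revert h0
    cases h.choose u <;> cases h.choose v <;> simp
  · rw [coloringCode, dif_neg h, Set.not_nonempty_iff_eq_empty.1 h]
    rfl

/-- Alice sends a message of `k` bits, and Bob announces the answer. -/
theorem exists_oneWay_protocol {X Y : Type} (k : ℕ) (g : X → Fin k → Bool)
    (h : (Fin k → Bool) → Y → Bool) :
    ∃ P : DetProtocol X Y, P.cost ≤ k + 1 ∧ ∀ x y, P.eval x y = h (g x) y := by
  induction k with
  | zero =>
    refine ⟨.bobBit (h Fin.elim0) fun b => .output b, by simp [DetProtocol.cost], fun x y => ?_⟩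
    simp only [DetProtocol.eval]
    congr 1
    exact Subsingleton.elim _ _
  | succ k ih =>
    choose P hc he using fun b => ih (fun x => Fin.tail (g x)) (fun w => h (Fin.cons b w))
    refine ⟨.aliceBit (fun x => g x 0) P, ?_, fun x y => ?_⟩
    · have h0 := hc false
      have h1 := hc true
      simp only [DetProtocol.cost]
      omega
    · simp only [DetProtocol.eval]
      rw [he, Fin.cons_self_tail]

theorem detComplexity_le_of_message {X Y M : Type} [Fintype M] (k : ℕ) (hk : Fintype.card M ≤ 2 ^ k)
    (g : X → M) (h : M → Y → Bool) :
    detComplexity (fun x y => h (g x) y) ≤ (k + 1 : ℕ) := by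
  obtain ⟨e⟩ : Nonempty (M ↪ (Fin k → Bool)) :=
    Function.Embedding.nonempty_of_card_le (by simpa using hk)
  -- `Function.invFun` needs an element of `M`; if there is none, there are no inputs `x` and any
  -- protocol of the right cost will do.
  rcases isEmpty_or_nonempty M with hM | hM
  · obtain ⟨P, hP, -⟩ := exists_oneWay_protocol (X := X) (Y := Y) k (fun x => (hM.false (g x)).elim)
      fun _ _ => false
    exact (iInf₂_le P fun x => (hM.false (g x)).elim).trans (by exact_mod_cast hP)
  obtain ⟨P, hP, he⟩ := exists_oneWay_protocol k (fun x => e (g x))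
    (fun w => h (Function.invFun e w))
  refine (iInf₂_le P fun x y => ?_).trans (by exact_mod_cast hP)
  rw [he, Function.leftInverse_invFun e.injective]

/-- Each of the `n` entries of a code fits in `Nat.log 2 (2 * n) + 1` bits. One more bit makes room
for `none`, and one is Bob's answer. -/
theorem detComplexity_bipartite_le (n : ℕ) :
    detComplexity (bipartite n) ≤ (n * (Nat.log 2 (2 * n) + 1) + 2 : ℕ) := by
  classical
  have hf : bipartite n = fun G H =>
      (fun c H => decide (decodeColorings c ∩ properTwoColorings H).Nonempty) (coloringCode G) H := by
    funext G H
    rw [Bool.eq_iff_iff, bipartite_eq_true_iff, decide_eq_true_iff, decode_coloringCode]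
  rw [hf]
  refine detComplexity_le_of_message (n * (Nat.log 2 (2 * n) + 1) + 1) ?_ coloringCode
    fun c H => decide (decodeColorings c ∩ properTwoColorings H).Nonempty
  have h1 : (n * 2) ^ n ≤ (2 ^ (Nat.log 2 (2 * n) + 1)) ^ n :=
    Nat.pow_le_pow_left (by
      have := Nat.lt_pow_succ_log_self (b := 2) (by norm_num) (2 * n)
      rw [Nat.succ_eq_add_one] at this
      omega) n
  rw [← pow_mul, mul_comm _ n] at h1
  have h2 : 0 < 2 ^ (n * (Nat.log 2 (2 * n) + 1)) := by positivity
  simp only [Fintype.card_option, Fintype.card_fun, Fintype.card_prod, Fintype.card_fin,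
    Fintype.card_bool]
  rw [pow_succ]
  omega

theorem exists_detComplexity_bipartite_le_mul_log :
    ∃ C : ℝ, 0 < C ∧ ∀ᶠ n : ℕ in Filter.atTop,
      (detComplexity (bipartite n) : ℝ≥0∞) ≤ ENNReal.ofReal (C * (n * Real.log n)) := by
  refine ⟨6, by norm_num, Filter.eventually_atTop.2 ⟨3, fun n hn => ?_⟩⟩
  refine (ENat.toENNReal_mono (detComplexity_bipartite_le n)).trans ?_
  rw [ENat.toENNReal_coe, ← ENNReal.ofReal_natCast]
  refine ENNReal.ofReal_le_ofReal ?_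
  have hn' : (3 : ℝ) ≤ n := by exact_mod_cast hn
  have hlog : 1 ≤ Real.log n := by
    rw [Real.le_log_iff_exp_le (by linarith)]
    exact Real.exp_one_lt_d9.le.trans (by linarith)
  have h2 := Real.log_two_gt_d9
  have hL : (Nat.log 2 (2 * n) : ℝ) ≤ 3 * Real.log n := by
    refine (Real.natLog_le_logb _ _).trans ?_
    rw [Real.logb, div_le_iff₀ (by norm_num; linarith)]
    push_cast
    rw [Real.log_mul (by norm_num) (by linarith)]
    nlinarith
  push_cast
  nlinarith

/-! ### Comparing the models -/

theorem normSq_one : State.normSq (1 : State 1 1) = 1 := by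
  simp [State.normSq]

theorem entangledComplexity_le_quantumComplexity {X Y : Type} (f : X → Y → Bool) :
    entangledComplexity f ≤ quantumComplexity f :=
  le_iInf₂ fun P hP => (iInf₂_le 1 1).trans <| (iInf₂_le (1 : State 1 1) normSq_one).trans <| iInf₂_le P hP

/-- The measurement of a trivial register with a certain outcome. -/
noncomputable def certainMeasurement (v : Bool) : Measurement 1 1 :=
  ⟨fun s => if s = v then 1 else 0, by cases v <;> simp⟩

/-- A deterministic protocol as a quantum protocol with trivial registers. -/
noncomputable def DetProtocol.toQuantum {X Y : Type} : DetProtocol X Y → QProtocol X Y 1 1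
  | .output v => .aliceOutput fun _ => certainMeasurement v
  | .aliceBit g next => .aliceBit (fun x => certainMeasurement (g x)) fun s => (next s).toQuantum
  | .bobBit g next => .bobBit (fun y => certainMeasurement (g y)) fun s => (next s).toQuantum

theorem DetProtocol.cost_toQuantum {X Y : Type} (P : DetProtocol X Y) :
    P.toQuantum.cost = P.cost := by
  induction P with
  | output v => rfl
  | aliceBit g next ih => simp only [toQuantum, QProtocol.cost, cost, ih]
  | bobBit g next ih => simp only [toQuantum, QProtocol.cost, cost, ih]

/-- A certain measurement maps the state to zero on the branch not taken, so that branch contributes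
nothing. -/
theorem DetProtocol.prob_toQuantum_zero {X Y : Type} (P : DetProtocol X Y) (x : X) (y : Y)
    (v : Bool) : P.toQuantum.prob x y v 0 = 0 := by
  induction P with
  | output v => simp [toQuantum, QProtocol.prob, State.normSq]
  | aliceBit g next ih => simp [toQuantum, QProtocol.prob, ih]
  | bobBit g next ih => simp [toQuantum, QProtocol.prob, ih]

theorem DetProtocol.prob_toQuantum {X Y : Type} (P : DetProtocol X Y) (x : X) (y : Y) :
    P.toQuantum.prob x y (P.eval x y) 1 = 1 := by
  induction P with
  | output v => simp [toQuantum, QProtocol.prob, certainMeasurement, eval, normSq_one]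
  | aliceBit g next ih =>
    simp only [toQuantum, QProtocol.prob, eval, certainMeasurement]
    rw [Finset.sum_eq_single (g x)]
    · simpa using ih _
    · intro s _ hs
      simp [hs, prob_toQuantum_zero]
    · simp
  | bobBit g next ih =>
    simp only [toQuantum, QProtocol.prob, eval, certainMeasurement]
    rw [Finset.sum_eq_single (g y)]
    · simpa using ih _
    · intro s _ hs
      simp [hs, prob_toQuantum_zero]
    · simp

theorem quantumComplexity_le_detComplexity {X Y : Type} (f : X → Y → Bool) :
    quantumComplexity f ≤ detComplexity f := by
  refine le_iInf₂ fun P hP => ?_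
  rw [← P.cost_toQuantum]
  refine iInf₂_le P.toQuantum fun x y => ?_
  rw [← hP, P.prob_toQuantum]
  norm_num

/-! ### Contractions -/

section Contractions

open scoped Matrix.Norms.L2Operator

theorem norm_one_matrix_le_one {n : Type} [Fintype n] [DecidableEq n] :
    ‖(1 : Matrix n n ℂ)‖ ≤ 1 := by
  rw [← Matrix.diagonal_one, Matrix.l2_opNorm_diagonal, pi_norm_le_iff_of_nonneg zero_le_one]
  simp

theorem norm_le_one_of_isometry {m n : Type} [Fintype m] [Fintype n] [DecidableEq n]
    {V : Matrix m n ℂ} (hV : Vᴴ * V = 1) : ‖V‖ ≤ 1 := by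
  have h := Matrix.l2_opNorm_conjTranspose_mul_self V
  rw [hV] at h
  have h1 := norm_one_matrix_le_one (n := n)
  nlinarith [norm_nonneg V]

theorem norm_mul_le_one {l m n : Type} [Fintype l] [Fintype m] [Fintype n] [DecidableEq m]
    [DecidableEq n] {A : Matrix l m ℂ} {B : Matrix m n ℂ} (hA : ‖A‖ ≤ 1) (hB : ‖B‖ ≤ 1) :
    ‖A * B‖ ≤ 1 :=
  (Matrix.l2_opNorm_mul A B).trans (mul_le_one₀ hA (norm_nonneg _) hB)

theorem norm_conjTranspose_le_one {m n : Type} [Fintype m] [Fintype n] [DecidableEq m]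
    [DecidableEq n] {A : Matrix m n ℂ} (hA : ‖A‖ ≤ 1) : ‖Aᴴ‖ ≤ 1 := by
  rwa [Matrix.l2_opNorm_conjTranspose]

theorem norm_transpose_le_one_of_isometry {m n : Type} [Fintype m] [Fintype n] [DecidableEq m]
    [DecidableEq n] {V : Matrix m n ℂ} (hV : Vᴴ * V = 1) : ‖Vᵀ‖ ≤ 1 := by
  -- `Vᵀᴴ` is the entrywise conjugate of `V`, which is again an isometry.
  have h : (Vᵀᴴ)ᴴ * Vᵀᴴ = 1 := by
    rw [Matrix.conjTranspose_conjTranspose]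
    calc Vᵀ * Vᵀᴴ = (Vᴴ * V)ᵀ := by rw [Matrix.transpose_mul]; rfl
      _ = 1 := by rw [hV, Matrix.transpose_one]
  have h' := norm_conjTranspose_le_one (norm_le_one_of_isometry h)
  rwa [Matrix.conjTranspose_conjTranspose] at h'

theorem norm_submatrix_rows_le_one {l m n : Type} [Fintype l] [Fintype m] [Fintype n]
    [DecidableEq l] [DecidableEq m] [DecidableEq n] {A : Matrix m n ℂ} (hA : ‖A‖ ≤ 1) {f : l → m}
    (hf : f.Injective) : ‖A.submatrix f id‖ ≤ 1 := by
  -- Selecting rows is multiplication by `E`, whose adjoint is an isometry because `f` is injective.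
  set E : Matrix l m ℂ := (1 : Matrix m m ℂ).submatrix f id with hE
  have h1 : E * A = A.submatrix f id := by
    ext i j
    simp [hE, Matrix.mul_apply, Matrix.one_apply]
  have h2 : (Eᴴ)ᴴ * Eᴴ = 1 := by
    ext i j
    simp [hE, Matrix.mul_apply, Matrix.one_apply, hf.eq_iff, eq_comm]
  have h3 := norm_conjTranspose_le_one (norm_le_one_of_isometry h2)
  rw [Matrix.conjTranspose_conjTranspose] at h3
  rw [← h1]
  exact norm_mul_le_one h3 hA

theorem norm_submatrix_le_one {m n m' n' : Type} [Fintype m] [Fintype n] [Fintype m'] [Fintype n']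
    [DecidableEq m] [DecidableEq n] [DecidableEq m'] [DecidableEq n'] {A : Matrix m n ℂ}
    (hA : ‖A‖ ≤ 1) {f : m' → m} {g : n' → n} (hf : f.Injective) (hg : g.Injective) :
    ‖A.submatrix f g‖ ≤ 1 := by
  have h := norm_conjTranspose_le_one (norm_submatrix_rows_le_one
    (norm_conjTranspose_le_one (norm_submatrix_rows_le_one hA hf)) hg)
  simpa [Matrix.conjTranspose_submatrix] using h

/-- The part of an operator that leaves the message qubit in the basis state `t`. -/
def qubitSlice {α n : Type} (V : Matrix (α × Fin 2) n ℂ) (t : Fin 2) : Matrix α n ℂ :=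
  V.submatrix (fun i => (i, t)) id

theorem norm_qubitSlice_le_one {a b : ℕ} (V : QubitIsometry a b) (t : Fin 2) :
    ‖qubitSlice V.1 t‖ ≤ 1 :=
  norm_submatrix_rows_le_one (norm_le_one_of_isometry V.2) fun i j h => by simpa using h

theorem norm_qubitSlice_transpose_le_one {a b : ℕ} (V : QubitIsometry a b) (t : Fin 2) :
    ‖(qubitSlice V.1 t)ᵀ‖ ≤ 1 :=
  norm_submatrix_le_one (f := id) (g := fun i => (i, t)) (norm_transpose_le_one_of_isometry V.2)
    Function.injective_id fun i j h => by simpa using h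

/-- The isometry that stores the outcome of a measurement in an extra register. -/
def Measurement.stack {a b : ℕ} (M : Measurement a b) : Matrix (Fin b × Bool) (Fin a) ℂ :=
  fun p j => M.1 p.2 p.1 j

/-- Each measurement operator is thus a block of an isometry, and so it and its transpose are
contractions. -/
theorem Measurement.stack_isometry {a b : ℕ} (M : Measurement a b) :
    (M.stack)ᴴ * M.stack = 1 := by
  rw [← M.2]
  ext i j
  simp only [Matrix.mul_apply, Matrix.sum_apply, Matrix.conjTranspose_apply, stack,
    Fintype.sum_prod_type]
  rw [Finset.sum_comm]

theorem norm_measurement_le_one {a b : ℕ} (M : Measurement a b) (s : Bool) : ‖M.1 s‖ ≤ 1 :=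
  norm_submatrix_rows_le_one (f := fun i => (i, s)) (norm_le_one_of_isometry M.stack_isometry)
    fun i j h => by simpa using h

theorem norm_measurement_transpose_le_one {a b : ℕ} (M : Measurement a b) (s : Bool) :
    ‖(M.1 s)ᵀ‖ ≤ 1 :=
  norm_submatrix_le_one (f := id) (g := fun i => (i, s))
    (norm_transpose_le_one_of_isometry M.stack_isometry)
    Function.injective_id fun i j h => by simpa using h

theorem normSq_eq_trace {a b : ℕ} (ψ : State a b) : (ψ.normSq : ℂ) = (ψᴴ * ψ).trace := by
  simp only [State.normSq, Matrix.trace, Matrix.diag_apply, Matrix.mul_apply,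
    Matrix.conjTranspose_apply, Complex.star_def, Complex.conj_mul']
  rw [Finset.sum_comm]
  push_cast
  rfl

theorem normSq_conjTranspose {a b : ℕ} (ψ : State a b) : State.normSq ψᴴ = ψ.normSq := by
  simp only [State.normSq, Matrix.conjTranspose_apply, norm_star]
  exact Finset.sum_comm

theorem normSq_mul_le {a b c : ℕ} {A : Matrix (Fin c) (Fin a) ℂ} (hA : ‖A‖ ≤ 1) (ψ : State a b) :
    State.normSq (A * ψ) ≤ ψ.normSq := by
  simp only [State.normSq]
  rw [Finset.sum_comm, Finset.sum_comm (s := Finset.univ (α := Fin a))]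
  refine Finset.sum_le_sum fun j _ => ?_
  have h := Matrix.l2_opNorm_mulVec A (WithLp.toLp 2 fun i => ψ i j)
  have h' := h.trans (mul_le_of_le_one_left (norm_nonneg _) hA)
  have h'' := pow_le_pow_left₀ (norm_nonneg _) h' 2
  rw [EuclideanSpace.norm_sq_eq, EuclideanSpace.norm_sq_eq] at h''
  exact h''

theorem normSq_mul_right_le {a b c : ℕ} {C : Matrix (Fin b) (Fin c) ℂ} (hC : ‖C‖ ≤ 1)
    (ψ : State a b) : State.normSq (ψ * C) ≤ ψ.normSq := by
  rw [← normSq_conjTranspose, Matrix.conjTranspose_mul, ← normSq_conjTranspose ψ]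
  exact normSq_mul_le (norm_conjTranspose_le_one hC) _

/-! ### Norm preservation -/

theorem sum_normSq_measurement {a a' b : ℕ} (M : Measurement a a') (ψ : State a b) :
    ∑ s, State.normSq (M.1 s * ψ) = ψ.normSq := by
  apply Complex.ofReal_injective
  push_cast
  simp only [normSq_eq_trace, Matrix.conjTranspose_mul, Matrix.mul_assoc]
  simp only [← Matrix.mul_assoc (M.1 _)ᴴ]
  rw [← Matrix.trace_sum, ← Matrix.mul_sum, ← Matrix.sum_mul, M.2, Matrix.one_mul]

theorem sum_normSq_measurement_right {a b b' : ℕ} (M : Measurement b b') (ψ : State a b) :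
    ∑ s, State.normSq (ψ * (M.1 s)ᵀ) = ψ.normSq := by
  have h : ∀ φ : State a b, State.normSq φᵀ = φ.normSq := fun φ => Finset.sum_comm
  have h' : ∀ φ : State a b', State.normSq φᵀ = φ.normSq := fun φ => Finset.sum_comm
  simp only [← h', ← h ψ, Matrix.transpose_mul, Matrix.transpose_transpose]
  exact sum_normSq_measurement M ψᵀ

theorem normSq_qubitToBob {a a' b : ℕ} (V : QubitIsometry a a') (ψ : State a b) :
    State.normSq (qubitToBob (V.1 * ψ)) = ψ.normSq := by
  apply Complex.ofReal_injective
  have h : (ψ.normSq : ℂ) = ((V.1 * ψ)ᴴ * (V.1 * ψ)).trace := by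
    rw [normSq_eq_trace, Matrix.conjTranspose_mul, Matrix.mul_assoc, ← Matrix.mul_assoc (V.1)ᴴ, V.2,
      Matrix.one_mul]
  rw [h]
  simp only [State.normSq, Matrix.trace, Matrix.diag_apply, Matrix.mul_apply (M := (V.1 * ψ)ᴴ),
    Matrix.conjTranspose_apply, Complex.star_def, Complex.conj_mul', qubitToBob]
  push_cast
  rw [Finset.sum_comm, ← finProdFinEquiv.sum_comp, Fintype.sum_prod_type]
  refine Finset.sum_congr rfl fun j _ => ?_
  simp only [Equiv.symm_apply_apply, Fintype.sum_prod_type]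
  exact Finset.sum_comm

theorem normSq_qubitToAlice {a b b' : ℕ} (V : QubitIsometry b b') (ψ : State a b) :
    State.normSq (qubitToAlice (ψ * (V.1)ᵀ)) = ψ.normSq := by
  have h : State.normSq ψᵀ = ψ.normSq := Finset.sum_comm
  rw [← h, ← normSq_qubitToBob V ψᵀ]
  have h' : qubitToAlice (ψ * (V.1)ᵀ) = (qubitToBob (V.1 * ψᵀ))ᵀ := by
    rw [← Matrix.transpose_transpose (V.1 * ψᵀ), Matrix.transpose_mul, Matrix.transpose_transpose]
    rfl
  rw [h']
  exact Finset.sum_comm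

/-- Every step preserves total squared norm. For a unit state this bounds the probability of the
wrong output by `1/3`. -/
theorem QProtocol.sum_prob {X Y : Type} {a b : ℕ} (P : QProtocol X Y a b) (x : X) (y : Y)
    (ψ : State a b) : ∑ v, P.prob x y v ψ = ψ.normSq := by
  induction P with
  | aliceOutput M => exact sum_normSq_measurement _ _
  | bobOutput M => exact sum_normSq_measurement_right _ _
  | aliceBit M next ih =>
    simp only [prob]
    rw [Finset.sum_comm]
    simp only [ih]
    exact sum_normSq_measurement _ _
  | bobBit M next ih =>
    simp only [prob]
    rw [Finset.sum_comm]
    simp only [ih]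
    exact sum_normSq_measurement_right _ _
  | aliceQubit V next ih =>
    simp only [prob, ih]
    exact normSq_qubitToBob _ _
  | bobQubit V next ih =>
    simp only [prob, ih]
    exact normSq_qubitToAlice _ _

end Contractions

/-! ### Acceptance probabilities as short sums of local terms -/

section Separable

open scoped Matrix.Norms.L2Operator

/-- A basis state of the larger register, from a basis state of the smaller one and a qubit. -/
def qubitIndex {b : ℕ} (t : Fin 2) (j : Fin b) : Fin (b * 2) := finProdFinEquiv (j, t)

theorem qubitIndex_injective {b : ℕ} (t : Fin 2) : (qubitIndex (b := b) t).Injective := by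
  intro i j h
  simpa using finProdFinEquiv.injective h

theorem trace_mul_eq_sum_qubit {b : ℕ} (S C : Matrix (Fin (b * 2)) (Fin (b * 2)) ℂ) :
    (S * C).trace = ∑ t, ∑ t', (S.submatrix (qubitIndex t) (qubitIndex t') *
      C.submatrix (qubitIndex t') (qubitIndex t)).trace := by
  simp only [Matrix.trace, Matrix.diag_apply, Matrix.mul_apply, Matrix.submatrix_apply]
  rw [← finProdFinEquiv.sum_comp, Fintype.sum_prod_type, Finset.sum_comm]
  refine Finset.sum_congr rfl fun t _ => ?_
  rw [Finset.sum_comm (s := Finset.univ (α := Fin 2))]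
  refine Finset.sum_congr rfl fun j _ => ?_
  rw [← finProdFinEquiv.sum_comp, Fintype.sum_prod_type, Finset.sum_comm]
  rfl

/-- Pulls a product observable back through a qubit message. Splitting Bob's enlarged register into
blocks by the qubit's basis states gives four product terms, one for each pair `t`, `t'`. -/
theorem trace_qubitToBob {a a' b : ℕ} (V : Matrix (Fin a' × Fin 2) (Fin a) ℂ) (ψ : State a b)
    (A : Matrix (Fin a') (Fin a') ℂ) (C : Matrix (Fin (b * 2)) (Fin (b * 2)) ℂ) :
    ((qubitToBob (V * ψ))ᴴ * A * qubitToBob (V * ψ) * C).trace =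
      ∑ t, ∑ t', (ψᴴ * ((qubitSlice V t)ᴴ * A * qubitSlice V t') * ψ *
        C.submatrix (qubitIndex t') (qubitIndex t)).trace := by
  rw [trace_mul_eq_sum_qubit]
  refine Finset.sum_congr rfl fun t _ => Finset.sum_congr rfl fun t' _ => ?_
  have h : ∀ t, (qubitToBob (V * ψ)).submatrix id (qubitIndex t) = qubitSlice V t * ψ := by
    intro t
    ext i j
    simp [qubitToBob, qubitIndex, qubitSlice, Matrix.mul_apply]
  have h' : ((qubitToBob (V * ψ))ᴴ * A * qubitToBob (V * ψ)).submatrix (qubitIndex t)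
      (qubitIndex t') = (qubitSlice V t * ψ)ᴴ * A * (qubitSlice V t' * ψ) := by
    rw [← h, ← h]
    rfl
  rw [h', Matrix.conjTranspose_mul]
  simp only [Matrix.mul_assoc]

theorem trace_qubitToAlice {a b b' : ℕ} (V : Matrix (Fin b' × Fin 2) (Fin b) ℂ) (ψ : State a b)
    (A : Matrix (Fin (a * 2)) (Fin (a * 2)) ℂ) (C : Matrix (Fin b') (Fin b') ℂ) :
    ((qubitToAlice (ψ * Vᵀ))ᴴ * A * qubitToAlice (ψ * Vᵀ) * C).trace =
      ∑ t, ∑ t', (ψᴴ * A.submatrix (qubitIndex t') (qubitIndex t) * ψ *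
        ((qubitSlice V t)ᵀ * C * (qubitSlice V t')ᵀᴴ)).trace := by
  have h : ∀ t, (qubitToAlice (ψ * Vᵀ)).submatrix (qubitIndex t) id =
      ψ * (qubitSlice V t)ᵀ := by
    intro t
    ext i j
    simp [qubitToAlice, qubitIndex, qubitSlice, Matrix.mul_apply]
  set φ := qubitToAlice (ψ * Vᵀ)
  -- Cyclicity of the trace moves the products to Alice's register, which is the one to be split
  -- into blocks here.
  have h' : (φᴴ * A * φ * C).trace = (φ * C * φᴴ * A).trace := by
    rw [Matrix.mul_assoc (φᴴ * A), Matrix.mul_assoc φᴴ, Matrix.trace_mul_comm, Matrix.mul_assoc,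
      Matrix.trace_mul_comm]
  rw [h', trace_mul_eq_sum_qubit]
  refine Finset.sum_congr rfl fun t _ => Finset.sum_congr rfl fun t' _ => ?_
  have h2 : (φ * C * φᴴ).submatrix (qubitIndex t) (qubitIndex t') =
      (ψ * (qubitSlice V t)ᵀ) * C * (ψ * (qubitSlice V t')ᵀ)ᴴ := by
    rw [← h, ← h]
    rfl
  rw [h2, Matrix.conjTranspose_mul, Matrix.trace_mul_comm]
  simp only [← Matrix.mul_assoc]
  rw [Matrix.trace_mul_comm]
  simp only [← Matrix.mul_assoc]

/-- Probabilities of a protocol are sums of at most `4 ^ cost` terms, each given by contractions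
local to the two players. -/
theorem QProtocol.exists_local_terms {X Y : Type} {a b : ℕ} (P : QProtocol X Y a b) (v : Bool) :
    ∃ (ι : Type) (_ : Fintype ι) (A : ι → X → Matrix (Fin a) (Fin a) ℂ)
      (C : ι → Y → Matrix (Fin b) (Fin b) ℂ), Fintype.card ι ≤ 4 ^ P.cost ∧
      (∀ k x, ‖A k x‖ ≤ 1) ∧ (∀ k y, ‖C k y‖ ≤ 1) ∧
      ∀ x y ψ, (P.prob x y v ψ : ℂ) = ∑ k, (ψᴴ * A k x * ψ * C k y).trace := by
  -- A classical bit only adds the terms of its two branches, and `2 * 4 ^ c ≤ 4 ^ (1 + c)`; the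
  -- factor `4` is needed for a qubit.
  have card_sigma_le : ∀ (ι : Bool → Type) [∀ s, Fintype (ι s)] (c : Bool → ℕ),
      (∀ s, Fintype.card (ι s) ≤ 4 ^ c s) →
      Fintype.card (Σ s, ι s) ≤ 4 ^ (1 + max (c false) (c true)) := by
    intro ι _ c h
    have h0 := (h false).trans (Nat.pow_le_pow_right (by norm_num) (le_max_left _ (c true)))
    have h1 := (h true).trans (Nat.pow_le_pow_right (by norm_num) (le_max_right (c false) _))
    rw [Fintype.card_sigma, Fintype.sum_bool, pow_add]
    omega
  induction P with
  | aliceOutput M =>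
    refine ⟨Unit, inferInstance, fun _ x => ((M x).1 v)ᴴ * (M x).1 v, fun _ _ => 1, by simp [cost],
      fun _ x => ?_, fun _ _ => norm_one_matrix_le_one, fun x y ψ => ?_⟩
    · have := norm_measurement_le_one (M x) v
      exact norm_mul_le_one (norm_conjTranspose_le_one this) this
    · simp [prob, normSq_eq_trace, Matrix.conjTranspose_mul, Matrix.mul_assoc]
  | bobOutput M =>
    refine ⟨Unit, inferInstance, fun _ _ => 1, fun _ y => ((M y).1 v)ᵀ * ((M y).1 v)ᵀᴴ,
      by simp [cost], fun _ _ => norm_one_matrix_le_one, fun _ y => ?_, fun x y ψ => ?_⟩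
    · have := norm_measurement_transpose_le_one (M y) v
      exact norm_mul_le_one this (norm_conjTranspose_le_one this)
    · simp only [prob, normSq_eq_trace, Matrix.conjTranspose_mul, Finset.univ_unique,
        Finset.sum_singleton, Matrix.mul_one]
      rw [Matrix.mul_assoc, Matrix.trace_mul_comm]
      simp only [Matrix.mul_assoc]
  | aliceBit M next ih =>
    choose ι fι A C hcard hA hC hp using ih
    refine ⟨Σ s, ι s, inferInstance, fun k x => ((M x).1 k.1)ᴴ * A k.1 k.2 x * (M x).1 k.1,
      fun k y => C k.1 k.2 y, card_sigma_le ι _ hcard, fun k x => ?_, fun k y => hC _ _ _,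
      fun x y ψ => ?_⟩
    · have := norm_measurement_le_one (M x) k.1
      exact norm_mul_le_one (norm_mul_le_one (norm_conjTranspose_le_one this) (hA _ _ _)) this
    · simp only [prob]
      push_cast
      rw [Fintype.sum_sigma]
      refine Finset.sum_congr rfl fun s _ => ?_
      rw [hp]
      simp only [Matrix.conjTranspose_mul, Matrix.mul_assoc]
  | bobBit M next ih =>
    choose ι fι A C hcard hA hC hp using ih
    refine ⟨Σ s, ι s, inferInstance, fun k x => A k.1 k.2 x,
      fun k y => ((M y).1 k.1)ᵀ * C k.1 k.2 y * ((M y).1 k.1)ᵀᴴ, card_sigma_le ι _ hcard,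
      fun k x => hA _ _ _, fun k y => ?_, fun x y ψ => ?_⟩
    · have := norm_measurement_transpose_le_one (M y) k.1
      exact norm_mul_le_one (norm_mul_le_one this (hC _ _ _)) (norm_conjTranspose_le_one this)
    · simp only [prob]
      push_cast
      rw [Fintype.sum_sigma]
      refine Finset.sum_congr rfl fun s _ => ?_
      rw [hp]
      refine Finset.sum_congr rfl fun k _ => ?_
      simp only [Matrix.conjTranspose_mul, Matrix.mul_assoc]
      rw [Matrix.trace_mul_comm]
      simp only [Matrix.mul_assoc]
  | aliceQubit V next ih =>
    obtain ⟨ι, fι, A, C, hcard, hA, hC, hp⟩ := ih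
    refine ⟨Fin 2 × Fin 2 × ι, inferInstance,
      fun k x => (qubitSlice (V x).1 k.1)ᴴ * A k.2.2 x * qubitSlice (V x).1 k.2.1,
      fun k y => (C k.2.2 y).submatrix (qubitIndex k.2.1) (qubitIndex k.1), ?_, fun k x => ?_,
      fun k y => norm_submatrix_le_one (hC _ _) (qubitIndex_injective _) (qubitIndex_injective _),
      fun x y ψ => ?_⟩
    · simp only [Fintype.card_prod, Fintype.card_fin, cost, pow_add]
      omega
    · exact norm_mul_le_one (norm_mul_le_one
        (norm_conjTranspose_le_one (norm_qubitSlice_le_one _ _)) (hA _ _))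
        (norm_qubitSlice_le_one _ _)
    · simp only [prob]
      rw [hp, Fintype.sum_prod_type]
      simp only [trace_qubitToBob, Fintype.sum_prod_type]
      rw [Finset.sum_comm]
      exact Finset.sum_congr rfl fun t _ => Finset.sum_comm
  | bobQubit V next ih =>
    obtain ⟨ι, fι, A, C, hcard, hA, hC, hp⟩ := ih
    refine ⟨Fin 2 × Fin 2 × ι, inferInstance,
      fun k x => (A k.2.2 x).submatrix (qubitIndex k.2.1) (qubitIndex k.1),
      fun k y => (qubitSlice (V y).1 k.1)ᵀ * C k.2.2 y * (qubitSlice (V y).1 k.2.1)ᵀᴴ,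
      ?_, fun k x => norm_submatrix_le_one (hA _ _) (qubitIndex_injective _)
        (qubitIndex_injective _), fun k y => ?_, fun x y ψ => ?_⟩
    · simp only [Fintype.card_prod, Fintype.card_fin, cost, pow_add]
      omega
    · exact norm_mul_le_one (norm_mul_le_one (norm_qubitSlice_transpose_le_one _ _) (hC _ _))
        (norm_conjTranspose_le_one (norm_qubitSlice_transpose_le_one _ _))
    · simp only [prob]
      rw [hp, Fintype.sum_prod_type]
      simp only [trace_qubitToAlice, Fintype.sum_prod_type]
      rw [Finset.sum_comm]
      exact Finset.sum_congr rfl fun t _ => Finset.sum_comm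

/-! ### The spectral bound -/

/-- The amplitudes of a state as a vector of a Hilbert space. -/
noncomputable def State.toVector {a b : ℕ} (ψ : State a b) : EuclideanSpace ℂ (Fin a × Fin b) :=
  WithLp.toLp 2 fun p => ψ p.1 p.2

theorem State.norm_toVector_sq {a b : ℕ} (ψ : State a b) : ‖ψ.toVector‖ ^ 2 = ψ.normSq := by
  rw [EuclideanSpace.norm_sq_eq, Fintype.sum_prod_type]
  rfl

theorem State.inner_toVector {a b : ℕ} (φ ψ : State a b) :
    inner ℂ φ.toVector ψ.toVector = (φᴴ * ψ).trace := by
  rw [PiLp.inner_apply, Fintype.sum_prod_type, Finset.sum_comm]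
  simp only [Matrix.trace, Matrix.diag_apply, Matrix.mul_apply, Matrix.conjTranspose_apply]
  refine Finset.sum_congr rfl fun j _ => Finset.sum_congr rfl fun i _ => ?_
  rw [RCLike.inner_apply, mul_comm]
  rfl

/-- Lindsey's lemma for vectors: a matrix with orthogonal rows of squared length `N` has a small
sum against inner products of vectors in the unit ball. -/
theorem norm_sum_mul_inner_sq_le {X Y E : Type} [Fintype X] [Fintype Y] [DecidableEq X]
    [NormedAddCommGroup E] [InnerProductSpace ℂ E] (H : X → Y → ℝ) (N : ℝ) (hN : 0 ≤ N)
    (hH : ∀ x x', ∑ y, H x y * H x' y = if x = x' then N else 0) (u : X → E) (w : Y → E)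
    (hu : ∀ x, ‖u x‖ ^ 2 ≤ 1) (hw : ∀ y, ‖w y‖ ^ 2 ≤ 1) :
    ‖∑ x, ∑ y, (H x y : ℂ) * inner ℂ (w y) (u x)‖ ^ 2 ≤
      Fintype.card Y * (N * Fintype.card X) := by
  set z : Y → E := fun y => ∑ x, (H x y : ℂ) • u x with hz
  have h1 : ∑ x, ∑ y, (H x y : ℂ) * inner ℂ (w y) (u x) = ∑ y, inner ℂ (w y) (z y) := by
    rw [Finset.sum_comm]
    simp only [hz, inner_sum, inner_smul_right]
  have h2 : ‖∑ y, inner ℂ (w y) (z y)‖ ≤ ∑ y, ‖z y‖ := by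
    refine (norm_sum_le _ _).trans (Finset.sum_le_sum fun y _ => ?_)
    refine (norm_inner_le_norm _ _).trans (mul_le_of_le_one_left (norm_nonneg _) ?_)
    exact (sq_le_one_iff₀ (norm_nonneg _)).1 (hw y)
  -- Expanding the squares, orthogonality of the rows of `H` kills all terms with `x ≠ x'`.
  have h3 : ((∑ y, ‖z y‖ ^ 2 : ℝ) : ℂ) = ((∑ x, N * ‖u x‖ ^ 2 : ℝ) : ℂ) := by
    have h4 : ∀ y, ((‖z y‖ ^ 2 : ℝ) : ℂ) =
        ∑ x, ∑ x', ((H x y * H x' y : ℝ) : ℂ) * inner ℂ (u x) (u x') := by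
      intro y
      push_cast
      refine (inner_self_eq_norm_sq_to_K (𝕜 := ℂ) (z y)).symm.trans ?_
      simp only [hz, sum_inner, inner_sum, inner_smul_left, inner_smul_right, Complex.conj_ofReal,
        mul_assoc, Finset.mul_sum]
      rw [Finset.sum_comm]
      exact Finset.sum_congr rfl fun x _ => Finset.sum_congr rfl fun x' _ => mul_left_comm _ _ _
    rw [Complex.ofReal_sum]
    simp only [h4]
    rw [Finset.sum_comm, Complex.ofReal_sum]
    refine Finset.sum_congr rfl fun x _ => ?_
    rw [Finset.sum_comm]
    simp only [← Finset.sum_mul, ← Complex.ofReal_sum, hH]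
    rw [Finset.sum_eq_single x]
    · rw [if_pos rfl, inner_self_eq_norm_sq_to_K]
      push_cast
      rfl
    · intro x' _ hx'
      simp [hx'.symm]
    · simp
  have h3' := Complex.ofReal_injective h3
  calc ‖∑ x, ∑ y, (H x y : ℂ) * inner ℂ (w y) (u x)‖ ^ 2
      ≤ (∑ y, ‖z y‖) ^ 2 := by rw [h1]; exact pow_le_pow_left₀ (norm_nonneg _) h2 2
    _ ≤ Fintype.card Y * ∑ y, ‖z y‖ ^ 2 := by
      simpa using sq_sum_le_card_mul_sum_sq (s := Finset.univ (α := Y)) (f := fun y => ‖z y‖)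
    _ ≤ Fintype.card Y * (N * Fintype.card X) := by
      rw [h3', ← Finset.mul_sum]
      gcongr
      calc ∑ x, ‖u x‖ ^ 2 ≤ ∑ _x : X, (1 : ℝ) := Finset.sum_le_sum fun x _ => hu x
        _ = Fintype.card X := by simp

/-- Each local term is the inner product of `ψ C(y)ᴴ` with `A(x) ψ`. Contractions keep both in the
unit ball, so Lindsey's lemma applies term by term. -/
theorem QProtocol.abs_sum_mul_prob_le {X Y X' Y' : Type} [Fintype X] [Fintype Y] [DecidableEq X]
    (H : X → Y → ℝ) (N : ℝ) (hN : 0 ≤ N)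
    (hH : ∀ x x', ∑ y, H x y * H x' y = if x = x' then N else 0) {a b : ℕ}
    (P : QProtocol X' Y' a b) (ψ : State a b) (hψ : ψ.normSq = 1) (v : Bool) (g : X → X')
    (h : Y → Y') :
    |∑ x, ∑ y, H x y * P.prob (g x) (h y) v ψ| ≤
      4 ^ P.cost * √(Fintype.card Y * (N * Fintype.card X)) := by
  obtain ⟨ι, fι, A, C, hcard, hA, hC, hp⟩ := P.exists_local_terms v
  have hk : ∀ k, ‖∑ x, ∑ y, (H x y : ℂ) * (ψᴴ * A k (g x) * ψ * C k (h y)).trace‖ ≤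
      √(Fintype.card Y * (N * Fintype.card X)) := by
    intro k
    refine Real.le_sqrt_of_sq_le ?_
    have := norm_sum_mul_inner_sq_le H N hN hH (fun x => State.toVector (A k (g x) * ψ))
      (fun y => State.toVector (ψ * (C k (h y))ᴴ))
      (fun x => by
        rw [State.norm_toVector_sq, ← hψ]
        exact normSq_mul_le (hA _ _) _)
      (fun y => by
        rw [State.norm_toVector_sq, ← hψ]
        exact normSq_mul_right_le (norm_conjTranspose_le_one (hC _ _)) _)
    have e : ∀ x y, inner ℂ (State.toVector (ψ * (C k (h y))ᴴ)) (State.toVector (A k (g x) * ψ)) =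
        (ψᴴ * A k (g x) * ψ * C k (h y)).trace := by
      intro x y
      rw [State.inner_toVector, Matrix.conjTranspose_mul, Matrix.conjTranspose_conjTranspose,
        Matrix.mul_assoc, Matrix.trace_mul_comm]
      simp only [Matrix.mul_assoc]
    simpa only [e] using this
  have hs : ((∑ x, ∑ y, H x y * P.prob (g x) (h y) v ψ : ℝ) : ℂ) =
      ∑ k, ∑ x, ∑ y, (H x y : ℂ) * (ψᴴ * A k (g x) * ψ * C k (h y)).trace := by
    push_cast
    simp only [hp, Finset.mul_sum]
    rw [Finset.sum_comm (s := Finset.univ (α := ι))]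
    exact Finset.sum_congr rfl fun x _ => Finset.sum_comm
  rw [← Real.norm_eq_abs, ← Complex.norm_real, hs]
  refine (norm_sum_le _ _).trans ((Finset.sum_le_sum fun k _ => hk k).trans ?_)
  rw [Finset.sum_const, nsmul_eq_mul, Finset.card_univ]
  gcongr
  exact_mod_cast hcard

end Separable

/-! ### The inner product matrix -/

/-- The sign of the inner product modulo two of two bit vectors. -/
def innerProductSign {m : ℕ} (x y : Fin m → Bool) : ℝ :=
  ∏ i, if x i && y i then -1 else 1

/-- The sum factors over coordinates; a coordinate where `x` and `x'` differ contributes the factor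
`1 - 1 = 0`. -/
theorem sum_innerProductSign_mul {m : ℕ} (x x' : Fin m → Bool) :
    ∑ y, innerProductSign x y * innerProductSign x' y = if x = x' then 2 ^ m else 0 := by
  have h : ∀ y : Fin m → Bool, innerProductSign x y * innerProductSign x' y =
      ∏ i, (if x i && y i then (-1 : ℝ) else 1) * (if x' i && y i then -1 else 1) :=
    fun y => Finset.prod_mul_distrib.symm
  simp only [h]
  rw [← Fintype.prod_sum fun i b => (if x i && b then (-1 : ℝ) else 1) *
    (if x' i && b then -1 else 1)]
  have h' : ∀ i, (∑ b, (if x i && b then (-1 : ℝ) else 1) * (if x' i && b then -1 else 1)) =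
      if x i = x' i then 2 else 0 := by
    intro i
    cases x i <;> cases x' i <;> norm_num
  simp only [h']
  split_ifs with hx
  · simp [hx]
  · obtain ⟨i, hi⟩ := Function.ne_iff.1 hx
    exact Finset.prod_eq_zero (Finset.mem_univ i) (if_neg hi)

theorem innerProductSign_eq_one_or {m : ℕ} (x y : Fin m → Bool) :
    innerProductSign x y = 1 ∨ innerProductSign x y = -1 := by
  unfold innerProductSign
  refine Finset.prod_induction _ (fun r : ℝ => r = 1 ∨ r = -1) ?_ (Or.inl rfl) fun i _ => ?_
  · rintro a b (rfl | rfl) (rfl | rfl) <;> norm_num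
  · split_ifs <;> simp

/-- Prefix parities of the inner product determine its sign. -/
theorem innerProductSign_eq_ite {m : ℕ} (x y : Fin m → Bool) (s : Fin (m + 1) → Bool)
    (hs : ∀ i : Fin m, s i.succ = xor (s i.castSucc) (x i && y i)) :
    innerProductSign x y = if s (Fin.last m) = s 0 then 1 else -1 := by
  induction m with
  | zero => simp [innerProductSign]
  | succ m ih =>
    have h := ih (x ∘ Fin.castSucc) (y ∘ Fin.castSucc) (s ∘ Fin.castSucc)
      fun i => hs i.castSucc
    have h' := hs (Fin.last m)
    rw [Fin.succ_last] at h'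
    simp only [innerProductSign, Function.comp_apply, Fin.castSucc_zero] at h
    rw [innerProductSign, Fin.prod_univ_castSucc, h, h']
    have cases_ite : ∀ p q r t : Bool, (if p = t then (1 : ℝ) else -1) *
        (if q && r then -1 else 1) = if xor p (q && r) = t then 1 else -1 := by
      rintro (_ | _) (_ | _) (_ | _) (_ | _) <;> simp
    exact cases_ite _ _ _ _

/-- A protocol that tells apart the two signs of the inner product of `m` bits costs about `m / 4`. -/
theorem QProtocol.le_cost_of_innerProductSign {X Y : Type} {f : X → Y → Bool} {a b : ℕ}
    (P : QProtocol X Y a b) (ψ : State a b) (hψ : ψ.normSq = 1) (hP : P.Computes ψ f) {m : ℕ}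
    (g : (Fin m → Bool) → X) (h : (Fin m → Bool) → Y)
    (hf : ∀ x y, f (g x) (h y) = true ↔ innerProductSign x y = 1) : m ≤ 4 * P.cost + 6 := by
  have bound := fun v => P.abs_sum_mul_prob_le innerProductSign (2 ^ m) (by positivity)
    sum_innerProductSign_mul ψ hψ v g h
  have hcard : (Fintype.card (Fin m → Bool) : ℝ) = 2 ^ m := by simp
  rw [hcard] at bound
  -- The right output has probability at least `2/3` and the wrong one at most `1/3`, so the signed
  -- bias is at least `1/3` at every input.
  have hpt : ∀ x y, 1 / 3 ≤ innerProductSign x y * P.prob (g x) (h y) true ψ -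
      innerProductSign x y * P.prob (g x) (h y) false ψ := by
    intro x y
    have hsum := P.sum_prob (g x) (h y) ψ
    rw [Fintype.sum_bool, hψ] at hsum
    have hc := hP (g x) (h y)
    rcases innerProductSign_eq_one_or x y with hs | hs
    · rw [(hf x y).2 hs] at hc
      rw [hs]
      linarith
    · have hfalse : f (g x) (h y) = false := by
        rw [← Bool.not_eq_true, hf, hs]
        norm_num
      rw [hfalse] at hc
      rw [hs]
      linarith
  have hlower : (2 ^ m * (2 ^ m * (1 / 3)) : ℝ) ≤
      ∑ x, ∑ y, innerProductSign x y * P.prob (g x) (h y) true ψ -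
      ∑ x, ∑ y, innerProductSign x y * P.prob (g x) (h y) false ψ := by
    simp only [← Finset.sum_sub_distrib]
    calc (2 ^ m * (2 ^ m * (1 / 3)) : ℝ)
        = ∑ _x : Fin m → Bool, ∑ _y : Fin m → Bool, (1 / 3 : ℝ) := by simp
      _ ≤ _ := Finset.sum_le_sum fun x _ => Finset.sum_le_sum fun y _ => hpt x y
  have ht := (le_abs_self _).trans (bound true)
  have hfl := (neg_le_abs _).trans (bound false)
  set r : ℝ := √(2 ^ m * (2 ^ m * 2 ^ m)) with hr
  have hr2 : r ^ 2 = 2 ^ m * (2 ^ m * 2 ^ m) := Real.sq_sqrt (by positivity)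
  have hmain : (2 ^ m * 2 ^ m : ℝ) ≤ 6 * 4 ^ P.cost * r := by linarith
  have hsq := pow_le_pow_left₀ (by positivity) hmain 2
  have hsq' : (2 ^ m * (2 ^ m * (2 ^ m * 2 ^ m)) : ℝ) ≤
      36 * (4 ^ P.cost) ^ 2 * (2 ^ m * (2 ^ m * 2 ^ m)) := by
    rw [← hr2]
    calc 2 ^ m * r ^ 2 = (2 ^ m * 2 ^ m) ^ 2 := by rw [hr2]; ring
      _ ≤ (6 * 4 ^ P.cost * r) ^ 2 := hsq
      _ = 36 * (4 ^ P.cost) ^ 2 * r ^ 2 := by ring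
  have hfin : (2 ^ m : ℝ) ≤ 36 * (4 ^ P.cost) ^ 2 :=
    le_of_mul_le_mul_right hsq' (by positivity)
  have h4 : ((4 ^ P.cost) ^ 2 : ℝ) = 2 ^ (4 * P.cost) := by
    rw [← pow_mul, show (4 : ℝ) = 2 ^ 2 by norm_num, ← pow_mul]
    congr 1
    ring
  -- The `6` in the exponent comes from `36 ≤ 2 ^ 6`.
  have hfin' : (2 ^ m : ℝ) ≤ 2 ^ (4 * P.cost + 6) := by
    rw [pow_add, ← h4]
    have : (0 : ℝ) ≤ (4 ^ P.cost) ^ 2 := by positivity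
    linarith
  exact (pow_le_pow_iff_right₀ (by norm_num : (1 : ℝ) < 2)).1 hfin'

/-! ### The inner product inside bipartiteness -/

theorem mem_properTwoColorings_fromRel {V : Type} (r : V → V → Prop) (hr : ∀ v, ¬ r v v)
    (χ : V → Bool) :
    χ ∈ properTwoColorings (SimpleGraph.fromRel r) ↔ ∀ u v, r u v → χ u ≠ χ v := by
  simp only [properTwoColorings, SimpleGraph.fromRel_adj, Set.mem_ofPred_eq]
  refine ⟨fun h u v e => h u v ⟨fun huv => hr v (huv ▸ e), Or.inl e⟩, ?_⟩
  rintro h u v ⟨-, e | e⟩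
  · exact h u v e
  · exact (h v u e).symm

/-- Alice's edges: from the hub of each layer to its port `1` or `2`, chosen by her bit, and a path
of length two that closes the cycle. -/
inductive AliceEdge {m : ℕ} (x : Fin m → Bool) : Fin (m + 1) × Fin 4 → Fin (m + 1) × Fin 4 → Prop
  | port (i : Fin m) : AliceEdge x (i.castSucc, 0) (i.castSucc, if x i then 2 else 1)
  | closeFirst : AliceEdge x (0, 0) (Fin.last m, 1)
  | closeLast : AliceEdge x (Fin.last m, 1) (Fin.last m, 0)

/-- Bob's edges: port `1` is joined to the hub of the next layer by an edge, port `2` by a path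
whose length is one or two according to his bit. -/
inductive BobEdge {m : ℕ} (y : Fin m → Bool) : Fin (m + 1) × Fin 4 → Fin (m + 1) × Fin 4 → Prop
  | direct (i : Fin m) : BobEdge y (i.castSucc, 1) (i.succ, 0)
  | short (i : Fin m) (h : y i = false) : BobEdge y (i.castSucc, 2) (i.succ, 0)
  | longFirst (i : Fin m) (h : y i = true) : BobEdge y (i.castSucc, 2) (i.castSucc, 3)
  | longLast (i : Fin m) (h : y i = true) : BobEdge y (i.castSucc, 3) (i.succ, 0)

theorem AliceEdge.irrefl {m : ℕ} (x : Fin m → Bool) (v : Fin (m + 1) × Fin 4) :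
    ¬ AliceEdge x v v := by
  have : ∀ u v, AliceEdge x u v → u.2 ≠ v.2 := by
    rintro _ _ (i | _ | _)
    · dsimp only
      split_ifs <;> decide
    · exact Fin.zero_ne_one
    · exact Fin.zero_ne_one.symm
  exact fun h => this v v h rfl

theorem BobEdge.irrefl {m : ℕ} (y : Fin m → Bool) (v : Fin (m + 1) × Fin 4) :
    ¬ BobEdge y v v := by
  have : ∀ u v, BobEdge y u v → u.2 ≠ v.2 := by
    rintro _ _ (i | i | i | i) <;> dsimp only <;> decide
  exact fun h => this v v h rfl

/-- From one hub to the next, the path through Alice's port has length two, or three exactly when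
both bits are set. Hub colours therefore follow the prefix parities, and the closing path of length
two forces the first and last hubs to agree. Ports not chosen by Alice only carry pendant paths,
which impose nothing. -/
theorem exists_coloring_iff_innerProductSign {m : ℕ} (x y : Fin m → Bool) :
    (properTwoColorings (SimpleGraph.fromRel (AliceEdge x)) ∩
      properTwoColorings (SimpleGraph.fromRel (BobEdge y))).Nonempty ↔
    innerProductSign x y = 1 := by
  constructor
  · rintro ⟨χ, hA, hB⟩
    rw [mem_properTwoColorings_fromRel _ (AliceEdge.irrefl x)] at hA
    rw [mem_properTwoColorings_fromRel _ (BobEdge.irrefl y)] at hB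
    rw [innerProductSign_eq_ite x y (fun i => χ (i, 0)), if_pos]
    · have h1 := hA _ _ AliceEdge.closeFirst
      have h2 := hA _ _ AliceEdge.closeLast
      revert h1 h2
      cases χ (0, 0) <;> cases χ (Fin.last m, 1) <;> cases χ (Fin.last m, 0) <;> simp
    · intro i
      have h1 := hA _ _ (AliceEdge.port i)
      have h2 := hB _ _ (BobEdge.direct i)
      cases hx : x i <;> cases hy : y i
      · rw [hx, if_neg Bool.false_ne_true] at h1
        revert h1 h2
        cases χ (i.castSucc, 0) <;> cases χ (i.castSucc, 1) <;> cases χ (i.succ, 0) <;> simp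
      · rw [hx, if_neg Bool.false_ne_true] at h1
        revert h1 h2
        cases χ (i.castSucc, 0) <;> cases χ (i.castSucc, 1) <;> cases χ (i.succ, 0) <;> simp
      · rw [hx, if_pos rfl] at h1
        have h3 := hB _ _ (BobEdge.short i hy)
        revert h1 h3
        cases χ (i.castSucc, 0) <;> cases χ (i.castSucc, 2) <;> cases χ (i.succ, 0) <;> simp
      · rw [hx, if_pos rfl] at h1
        have h3 := hB _ _ (BobEdge.longFirst i hy)
        have h4 := hB _ _ (BobEdge.longLast i hy)
        revert h1 h3 h4
        cases χ (i.castSucc, 0) <;> cases χ (i.castSucc, 2) <;> cases χ (i.castSucc, 3) <;>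
          cases χ (i.succ, 0) <;> simp
  · intro h
    let s : Fin (m + 1) → Bool := Fin.induction false fun i c => xor c (x i && y i)
    have hs : ∀ i : Fin m, s i.succ = xor (s i.castSucc) (x i && y i) := fun i => by
      simp only [s, Fin.induction_succ]
    have hclose : s (Fin.last m) = s 0 := by
      by_contra hne
      rw [innerProductSign_eq_ite x y s hs, if_neg hne] at h
      norm_num at h
    -- `s'` is the colour of the next hub. On the last layer it wraps around to the first hub, so
    -- port `1` there serves as the middle of the closing path.
    let s' : Fin (m + 1) → Bool := Fin.snoc (α := fun _ => Bool) (fun i => s i.succ) (s 0)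
    let y' : Fin (m + 1) → Bool := Fin.snoc (α := fun _ => Bool) y false
    have hs' : ∀ i : Fin m, s' i.castSucc = s i.succ := fun i => Fin.snoc_castSucc _ _ _
    have hy' : ∀ i : Fin m, y' i.castSucc = y i := fun i => Fin.snoc_castSucc _ _ _
    have hlast : s' (Fin.last m) = s 0 := Fin.snoc_last _ _
    let χ : Fin (m + 1) × Fin 4 → Bool := fun p =>
      ![s p.1, !s' p.1, xor (!s' p.1) (y' p.1), !s' p.1] p.2
    have e0 : ∀ i, χ (i, 0) = s i := fun _ => rfl
    have e1 : ∀ i, χ (i, 1) = !s' i := fun _ => rfl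
    have e2 : ∀ i, χ (i, 2) = xor (!s' i) (y' i) := fun _ => rfl
    have e3 : ∀ i, χ (i, 3) = !s' i := fun _ => rfl
    refine ⟨χ, ?_, ?_⟩
    · rw [mem_properTwoColorings_fromRel _ (AliceEdge.irrefl x)]
      rintro _ _ (i | _ | _)
      · cases hx : x i
        · simp [e0, e1, hs', hs, hx]
        · simp [e0, e2, hs', hs, hx, hy']
      · simp [e0, e1, hlast]
      · simp [e0, e1, hlast, hclose]
    · rw [mem_properTwoColorings_fromRel _ (BobEdge.irrefl y)]
      rintro _ _ (i | ⟨i, hy⟩ | ⟨i, hy⟩ | ⟨i, hy⟩)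
      · simp [e0, e1, hs']
      · simp [e0, e2, hs', hy', hy]
      · simp [e2, e3, hs', hy', hy]
      · simp [e0, e3, hs']

theorem le_cost_of_computes_bipartite {n : ℕ} (hn : 4 ≤ n) {a b : ℕ} (ψ : State a b)
    (hψ : ψ.normSq = 1) (P : QProtocol (SimpleGraph (Fin n)) (SimpleGraph (Fin n)) a b)
    (hP : P.Computes ψ (bipartite n)) : n ≤ 16 * P.cost + 31 := by
  -- The gadget graph has `4 * (m + 1)` vertices; then `n ≤ 4 * (m + 1) + 3` and `m ≤ 4 * cost + 6`
  -- give the constants `16` and `31`.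
  obtain ⟨m, hm⟩ : ∃ m, m + 1 = n / 4 := ⟨n / 4 - 1, by omega⟩
  obtain ⟨e⟩ : Nonempty (Fin (m + 1) × Fin 4 ↪ Fin n) :=
    Function.Embedding.nonempty_of_card_le (by
      simp only [Fintype.card_prod, Fintype.card_fin]
      omega)
  have := P.le_cost_of_innerProductSign ψ hψ hP (m := m)
    (fun x => (SimpleGraph.fromRel (AliceEdge x)).map e)
    (fun y => (SimpleGraph.fromRel (BobEdge y)).map e) fun x y => by
      rw [bipartite_eq_true_iff, ← exists_coloring_iff_innerProductSign,
        properTwoColorings_map_inter_nonempty]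
  omega

theorem exists_mul_le_entangledComplexity_bipartite :
    ∃ c : ℝ, 0 < c ∧ ∀ᶠ n : ℕ in Filter.atTop,
      ENNReal.ofReal (c * n) ≤ (entangledComplexity (bipartite n) : ℝ≥0∞) := by
  -- For `n ≥ 62` the additive `31` is at most `n / 2`, so `16 * cost ≥ n / 2`.
  refine ⟨1 / 32, by norm_num, Filter.eventually_atTop.2 ⟨62, fun n hn => ?_⟩⟩
  have hnat : (⌈(1 / 32 * n : ℝ)⌉₊ : ℕ∞) ≤ entangledComplexity (bipartite n) := by
    refine le_iInf₂ fun a b => le_iInf₂ fun ψ hψ => le_iInf₂ fun P hP => ?_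
    have h := le_cost_of_computes_bipartite (by omega) ψ hψ P hP
    refine Nat.cast_le.2 (Nat.ceil_le.2 ?_)
    have h' : (n : ℝ) ≤ 16 * P.cost + 31 := by exact_mod_cast h
    have hn' : (62 : ℝ) ≤ n := by exact_mod_cast hn
    linarith
  refine le_trans ?_ (ENat.toENNReal_mono hnat)
  rw [ENat.toENNReal_coe]
  exact ENNReal.ofReal_le_of_le_toReal (by simpa using Nat.le_ceil _)

end CommComplexity

theorem mainTheorem7 :
    (∃ c : ℝ, 0 < c ∧ ∀ᶠ n : ℕ in Filter.atTop, ENNReal.ofReal (c * n) ≤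
      (CommComplexity.entangledComplexity (CommComplexity.bipartite n) : ℝ≥0∞)) ∧
    (∀ n : ℕ, CommComplexity.entangledComplexity (CommComplexity.bipartite n) ≤
      CommComplexity.quantumComplexity (CommComplexity.bipartite n)) ∧
    (∀ n : ℕ, CommComplexity.quantumComplexity (CommComplexity.bipartite n) ≤
      CommComplexity.detComplexity (CommComplexity.bipartite n)) ∧
    (∃ C : ℝ, 0 < C ∧ ∀ᶠ n : ℕ in Filter.atTop,
      (CommComplexity.detComplexity (CommComplexity.bipartite n) : ℝ≥0∞) ≤
        ENNReal.ofReal (C * (n * Real.log n))) := by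
  exact ⟨CommComplexity.exists_mul_le_entangledComplexity_bipartite,
    fun n => CommComplexity.entangledComplexity_le_quantumComplexity _,
    fun n => CommComplexity.quantumComplexity_le_detComplexity _,
    CommComplexity.exists_detComplexity_bipartite_le_mul_log⟩
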